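/- Let $X$ be a finite-dimensional euclidean (real) vector space, and let $\mathcal F$ be a finite set of linear subspaces of $X$ which is stable under intersections and satisfies $\{0\}\in\mathcal F$ and $X\notin\mathcal F$. Let $\mathbb S_X$ be the set of rays $\mathbb R_+v$, $v\in X\smallsetminus\{0\}$, and let $\overline X=X\sqcup\mathbb S_X$ be the spherical compactification of $X$, with the structure of a smooth manifold with boundary for which the bijection $$\Theta:\overline X\to\{(t,x)\in\mathbb R\times X \mid t^2+\|x\|^2=1,\ t\ge 0\},\qquad \Theta(x)=\frac{(1,x)}{\sqrt{1+\|x\|^2}}\ (x\in X),\qquad \Theta(\mathbb R_+v)=\frac{(0,v)}{\|v\|}$$ is a diffeomorphism. For a linear subspace $Y\subset X$ let $\mathbb S_Y\subset\mathbb S_X$ be the set of rays contained in $Y$ (so $\mathbb S_{\{0\}}=\emptyset$) and $\overline Y=Y\sqcup\mathbb S_Y\subset\overline X$ (the closure of $Y$ in $\overline X$). Put $\overline{\mathcal F}=\{\overline Y\mid Y\in\mathcal F\}$ and $\mathbb S_{\mathcal F}=\{\mathbb S_Y\mid Y\in\mathcal F\}$. A subset $P$ of an $n$-dimensional manifold with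 corners $M$ is a p-submanifold if every $x\in P$ has an open neighborhood $U$ in $M$ with a smooth chart $\phi:U\to\mathbb R^n_k=[0,\infty)^k\times\mathbb R^{n-k}$ and a set $J\subset\{1,\dots,n\}$ such that $\phi(P\cap U)=\{y\in\phi(U)\mid y_i=0 \text{ for } i\in J\}$. A clean semilattice of p-submanifolds of $M$ is a finite set $\mathcal S$ of p-submanifolds of $M$ such that, for all $P,Q\in\mathcal S$, one has $P\cap Q\in\mathcal S$ and $T_x(P\cap Q)=T_xP\cap T_xQ$ for every $x\in P\cap Q$. Then each of the three families $\overline{\mathcal F}$, $\mathbb S_{\mathcal F}$ and $\mathbb S_{\mathcal F}\cup\overline{\mathcal F}$ is a clean semilattice of p-submanifolds of $\overline X$. -/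

import Mathlib

noncomputable section

open Set Module
open scoped Manifold ContDiff

/-! ### The local models of manifolds with corners -/

/-- The model `ℝⁿ_k = [0, ∞)ᵏ × ℝⁿ⁻ᵏ` (the first `k` coordinates are nonnegative). -/
abbrev Orthant (n k : ℕ) : Type :=
  {x : EuclideanSpace ℝ (Fin n) // ∀ i : Fin n, (i : ℕ) < k → 0 ≤ x i}

/-- The inclusion `ℝⁿ_k ⊆ ℝⁿ` as a model with corners. -/
def orthantModel (n k : ℕ) : ModelWithCorners ℝ (EuclideanSpace ℝ (Fin n)) (Orthant n k) where
  toFun := Subtype.val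
  invFun x := ⟨WithLp.toLp 2 fun i ↦ if (i : ℕ) < k then max (x i) 0 else x i, by
    intro i hi
    simp [hi]⟩
  source := univ
  target := {x | ∀ i : Fin n, (i : ℕ) < k → 0 ≤ x i}
  map_source' x _ := x.property
  map_target' _ _ := mem_univ _
  left_inv' x _ := by
    apply Subtype.ext
    ext i
    by_cases hi : (i : ℕ) < k
    · simp [hi, x.2 i hi]
    · simp [hi]
  right_inv' x hx := by
    ext i
    by_cases hi : (i : ℕ) < k
    · simp [hi, hx i hi]
    · simp [hi]
  source_eq := rfl
  convex_range' := by
    simp only [instIsRCLikeNormedField, ↓reduceDIte]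
    apply Convex.convex_isRCLikeNormedField
    have : range (Subtype.val : Orthant n k → EuclideanSpace ℝ (Fin n)) =
        {x | ∀ i : Fin n, (i : ℕ) < k → 0 ≤ x i} := Subtype.range_val
    rw [this]
    intro x hx y hy a b ha hb _ i hi
    have h1 := hx i hi
    have h2 := hy i hi
    simp only [PiLp.add_apply, PiLp.smul_apply, smul_eq_mul]
    positivity
  nonempty_interior' := by
    have : range (Subtype.val : Orthant n k → EuclideanSpace ℝ (Fin n)) =
        {x | ∀ i : Fin n, (i : ℕ) < k → 0 ≤ x i} := Subtype.range_val
    rw [this]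
    refine ⟨WithLp.toLp 2 fun _ ↦ 1, ?_⟩
    have hopen : IsOpen {x : EuclideanSpace ℝ (Fin n) | ∀ i, 0 < x i} := by
      simp only [ofPred_forall]
      exact isOpen_iInter_of_finite fun i ↦ isOpen_lt continuous_const (by fun_prop)
    exact interior_maximal (fun x hx i _ ↦ (hx i).le) hopen (by simp)
  continuous_toFun := continuous_subtype_val
  continuous_invFun := by
    refine Continuous.subtype_mk ((PiLp.continuous_toLp 2 _).comp <| continuous_pi fun i ↦ ?_) _
    by_cases hi : (i : ℕ) < k
    · simp only [hi, if_true]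
      fun_prop
    · simp only [hi, if_false]
      fun_prop

/-- The model `L_{J,k}ⁿ = {x ∈ ℝⁿ_k | x_i = 0 for i ∈ J}` of a p-submanifold. -/
def orthantFace {n k : ℕ} (J : Finset (Fin n)) : Set (Orthant n k) :=
  {x | ∀ i ∈ J, x.1 i = 0}

/-! ### p-submanifolds and clean intersections in a manifold with corners -/

section Corners

variable {n : ℕ} {H : Type*} [TopologicalSpace H]
  (I : ModelWithCorners ℝ (EuclideanSpace ℝ (Fin n)) H)
  {M : Type*} [TopologicalSpace M] [ChartedSpace H M]

/-- A smooth chart `φ : U → ℝⁿ_k` of `M`: a diffeomorphism from an open subset of `M` onto an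
open subset of `ℝⁿ_k`. -/
structure IsCornerChart {k : ℕ} (φ : OpenPartialHomeomorph M (Orthant n k)) : Prop where
  contMDiffOn : ContMDiffOn I (orthantModel n k) ∞ φ φ.source
  contMDiffOn_symm : ContMDiffOn (orthantModel n k) I ∞ φ.symm φ.target

/-- `P ⊆ M` is a p-submanifold: near each of its points some smooth chart `φ : U → ℝⁿ_k` of `M`
satisfies `φ(P ∩ U) = L_{J,k}ⁿ ∩ φ(U)`. -/
def IsPSubmanifold (P : Set M) : Prop :=
  ∀ x ∈ P, ∃ k ≤ n, ∃ (φ : OpenPartialHomeomorph M (Orthant n k)) (J : Finset (Fin n)),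
    IsCornerChart I φ ∧ x ∈ φ.source ∧ φ '' (P ∩ φ.source) = orthantFace J ∩ φ.target

/-- The inward pointing tangent vectors `γ'(0)` of `P` at `x`, for smooth curves
`γ : [0, ε) → M` inside `P` with `γ(0) = x`. -/
def inwardTangentVectors (P : Set M) (x : M) : Set (TangentSpace I x) :=
  {v | ∃ (γ : ℝ → M) (ε : ℝ) (hx : γ 0 = x), 0 < ε ∧ ContMDiffOn 𝓘(ℝ, ℝ) I ∞ γ (Ico 0 ε) ∧
    MapsTo γ (Ico 0 ε) P ∧
    v = hx ▸ (mfderivWithin 𝓘(ℝ, ℝ) I γ (Ico 0 ε) 0 (1 : ℝ) : TangentSpace I (γ 0))}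

/-- The tangent space `T_x P ⊆ T_x M` of a p-submanifold: the linear span of the inward pointing
tangent vectors. -/
def tangentSubspace (P : Set M) (x : M) : Submodule ℝ (TangentSpace I x) :=
  Submodule.span ℝ (inwardTangentVectors I P x)

/-- `P` and `Q` intersect cleanly: `P`, `Q`, `P ∩ Q` are p-submanifolds and
`T_x (P ∩ Q) = T_x P ∩ T_x Q` on `P ∩ Q`. -/
structure IntersectCleanly (P Q : Set M) : Prop where
  left : IsPSubmanifold I P
  right : IsPSubmanifold I Q
  inter : IsPSubmanifold I (P ∩ Q)
  tangent : ∀ x ∈ P ∩ Q, tangentSubspace I (P ∩ Q) x = tangentSubspace I P x ⊓ tangentSubspace I Q x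

/-- A clean semilattice of p-submanifolds of the manifold with corners `M`: a finite family of
p-submanifolds, stable under intersections, whose members pairwise intersect cleanly. -/
structure IsCleanSemilattice [IsManifold I ∞ M] (S : Set (Set M)) : Prop where
  finite : S.Finite
  isPSubmanifold : ∀ P ∈ S, IsPSubmanifold I P
  inter_mem : ∀ P ∈ S, ∀ Q ∈ S, P ∩ Q ∈ S
  clean : ∀ P ∈ S, ∀ Q ∈ S, IntersectCleanly I P Q

end Corners

/-! ### The half-sphere -/

section HalfSphere

variable (X : Type*) [NormedAddCommGroup X] [InnerProductSpace ℝ X]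

/-- The half-sphere `{(t, x) ∈ ℝ × X | t² + ‖x‖² = 1, t ≥ 0}`. -/
abbrev HalfSphere : Type _ :=
  {p : ℝ × X // p.1 ^ 2 + ‖p.2‖ ^ 2 = 1 ∧ 0 ≤ p.1}

variable {X}

variable {n : ℕ} [NeZero n] (b : OrthonormalBasis (Fin n) ℝ X)

/-- Coordinates on `ℝ × X` with the coordinate along `b 0` replaced by the `ℝ`-component. -/
def swapCoord (p : ℝ × X) : EuclideanSpace ℝ (Fin n) :=
  WithLp.toLp 2 fun i ↦ if i = 0 then p.1 else b.repr p.2 i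

/-- Stereographic projection from the boundary point `(0, s • b 0)`, `s = ±1`. -/
def halfStereo (s : ℝ) (p : ℝ × X) : EuclideanSpace ℝ (Fin n) :=
  (1 - s * b.repr p.2 0)⁻¹ • swapCoord b p

/-- Inverse of the stereographic projection from `(0, s • b 0)`. -/
def halfStereoInv (s : ℝ) (w : EuclideanSpace ℝ (Fin n)) : ℝ × X :=
  (‖w‖ ^ 2 + 1)⁻¹ • (2 * w 0, b.repr.symm (WithLp.toLp 2 fun i ↦
    if i = 0 then s * (‖w‖ ^ 2 - 1) else 2 * w i))

variable {b} {s : ℝ}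

theorem repr_sq_le {p : ℝ × X} (hp : p.1 ^ 2 + ‖p.2‖ ^ 2 = 1) : (b.repr p.2 0) ^ 2 ≤ 1 := by
  have h1 : ‖b.repr p.2 0‖ ≤ ‖b.repr p.2‖ := PiLp.norm_apply_le _ _
  rw [b.repr.norm_map, Real.norm_eq_abs] at h1
  have := abs_nonneg (b.repr p.2 0)
  have h3 := sq_abs (b.repr p.2 0)
  nlinarith [sq_nonneg p.1]

theorem one_sub_repr_nonneg (hs : s * s = 1) {p : ℝ × X} (hp : p.1 ^ 2 + ‖p.2‖ ^ 2 = 1) :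
    0 ≤ 1 - s * b.repr p.2 0 := by
  have := repr_sq_le (b := b) hp
  have h : (s * b.repr p.2 0) ^ 2 ≤ 1 := by
    calc (s * b.repr p.2 0) ^ 2 = (s * s) * (b.repr p.2 0) ^ 2 := by ring
      _ ≤ 1 := by rw [hs]; linarith
  nlinarith

theorem norm_swapCoord_sq (p : ℝ × X) :
    ‖swapCoord b p‖ ^ 2 = p.1 ^ 2 + ‖p.2‖ ^ 2 - (b.repr p.2 0) ^ 2 := by
  rw [← b.repr.norm_map p.2, EuclideanSpace.real_norm_sq_eq, EuclideanSpace.real_norm_sq_eq,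
    ← Finset.add_sum_erase _ _ (Finset.mem_univ (0 : Fin n)),
    ← Finset.add_sum_erase _ (fun i ↦ (b.repr p.2).ofLp i ^ 2) (Finset.mem_univ (0 : Fin n))]
  have : ∑ x ∈ Finset.univ.erase 0, (swapCoord b p).ofLp x ^ 2 =
      ∑ x ∈ Finset.univ.erase 0, (b.repr p.2).ofLp x ^ 2 :=
    Finset.sum_congr rfl fun i hi ↦ by simp [swapCoord, Finset.ne_of_mem_erase hi]
  rw [this]
  simp only [swapCoord, if_true]
  ring

theorem halfStereoInv_mem (hs : s * s = 1) (w : EuclideanSpace ℝ (Fin n)) :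
    (halfStereoInv b s w).1 ^ 2 + ‖(halfStereoInv b s w).2‖ ^ 2 = 1 := by
  have hpos : (0 : ℝ) < ‖w‖ ^ 2 + 1 := by positivity
  have key : ‖(WithLp.toLp 2 fun i ↦ if i = 0 then s * (‖w‖ ^ 2 - 1) else 2 * w i :
      EuclideanSpace ℝ (Fin n))‖ ^ 2 = (‖w‖ ^ 2 + 1) ^ 2 - (2 * w 0) ^ 2 := by
    have h2 : ‖w‖ ^ 2 = (w 0) ^ 2 + ∑ i ∈ Finset.univ.erase 0, (w i) ^ 2 := by
      rw [EuclideanSpace.real_norm_sq_eq, ← Finset.add_sum_erase _ _ (Finset.mem_univ (0 : Fin n))]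
    rw [EuclideanSpace.real_norm_sq_eq, ← Finset.add_sum_erase _ _ (Finset.mem_univ (0 : Fin n))]
    have : ∑ x ∈ Finset.univ.erase 0, (if x = 0 then s * (‖w‖ ^ 2 - 1) else 2 * w x) ^ 2 =
        4 * ∑ i ∈ Finset.univ.erase 0, (w i) ^ 2 := by
      rw [Finset.mul_sum]
      exact Finset.sum_congr rfl fun i hi ↦ by simp [Finset.ne_of_mem_erase hi]; ring
    simp only [if_true] at this ⊢
    rw [this]
    linear_combination (‖w‖ ^ 2 - 1) ^ 2 * hs - 4 * h2
  simp only [halfStereoInv, Prod.smul_mk, norm_smul, b.repr.symm.norm_map, mul_pow, key,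
    smul_eq_mul, Real.norm_eq_abs, sq_abs]
  field_simp
  ring

theorem halfStereoInv_halfStereo (hs : s * s = 1) {p : ℝ × X} (hp : p.1 ^ 2 + ‖p.2‖ ^ 2 = 1)
    (h : s * b.repr p.2 0 ≠ 1) : halfStereoInv b s (halfStereo b s p) = p := by
  have hD : 1 - s * b.repr p.2 0 ≠ 0 := fun h' ↦ h (by linarith)
  have hN : ‖halfStereo b s p‖ ^ 2 = (1 + s * b.repr p.2 0) * (1 - s * b.repr p.2 0)⁻¹ := by
    rw [halfStereo, norm_smul, mul_pow, norm_swapCoord_sq, hp, Real.norm_eq_abs, sq_abs]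
    field_simp
    linear_combination (b.repr p.2 0) ^ 2 * hs
  have hN1 : (‖halfStereo b s p‖ ^ 2 + 1)⁻¹ = (1 - s * b.repr p.2 0) / 2 := by
    rw [hN]
    field_simp
    ring
  rw [halfStereoInv, hN1, hN]
  refine Prod.ext ?_ ?_
  · simp [halfStereo, swapCoord]
    field_simp
  · rw [Prod.smul_mk]
    simp only
    apply b.repr.injective
    rw [map_smul, b.repr.apply_symm_apply]
    ext i
    by_cases hi : i = 0
    · subst hi
      simp
      field_simp
      linear_combination 2 * (b.repr p.2 0) * hs
    · simp [hi, halfStereo, swapCoord]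
      field_simp

theorem repr_halfStereoInv (w : EuclideanSpace ℝ (Fin n)) :
    b.repr (halfStereoInv b s w).2 0 = (‖w‖ ^ 2 + 1)⁻¹ * (s * (‖w‖ ^ 2 - 1)) := by
  simp [halfStereoInv]

theorem halfStereoInv_ne (hs : s * s = 1) (w : EuclideanSpace ℝ (Fin n)) :
    s * b.repr (halfStereoInv b s w).2 0 ≠ 1 := by
  have hpos : (0 : ℝ) < ‖w‖ ^ 2 + 1 := by positivity
  rw [repr_halfStereoInv]
  intro h
  field_simp at h
  have : s ^ 2 = 1 := by rw [sq, hs]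
  rw [this] at h
  linarith

theorem halfStereo_halfStereoInv (hs : s * s = 1) (w : EuclideanSpace ℝ (Fin n)) :
    halfStereo b s (halfStereoInv b s w) = w := by
  have hpos : (0 : ℝ) < ‖w‖ ^ 2 + 1 := by positivity
  have hD : (1 - s * b.repr (halfStereoInv b s w).2 0)⁻¹ = (‖w‖ ^ 2 + 1) / 2 := by
    rw [repr_halfStereoInv]
    have : 1 - s * ((‖w‖ ^ 2 + 1)⁻¹ * (s * (‖w‖ ^ 2 - 1))) = 2 / (‖w‖ ^ 2 + 1) := by
      field_simp
      linear_combination (1 - ‖w‖ ^ 2) * hs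
    rw [this, inv_div]
  rw [halfStereo, hD]
  ext i
  by_cases hi : i = 0
  · subst hi
    simp [swapCoord, halfStereoInv]
    field_simp
  · simp [hi, swapCoord, halfStereoInv]
    field_simp

theorem contDiff_swapCoord : ContDiff ℝ ∞ (swapCoord b) := by
  rw [contDiff_euclidean]
  intro i
  by_cases hi : i = 0
  · simp only [swapCoord, hi, if_true]
    exact contDiff_fst
  · simp only [swapCoord, hi, if_false]
    exact contDiff_euclidean.1 (b.repr.contDiff.comp contDiff_snd) i

theorem contDiffOn_halfStereo :
    ContDiffOn ℝ ∞ (halfStereo b s) {p | s * b.repr p.2 0 ≠ 1} := by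
  have h0 : ContDiff ℝ ∞ fun p : ℝ × X ↦ b.repr p.2 0 :=
    contDiff_euclidean.1 (b.repr.contDiff.comp contDiff_snd) 0
  have h1 : ContDiffOn ℝ ∞ (fun p : ℝ × X ↦ (1 - s * b.repr p.2 0)⁻¹)
      {p | s * b.repr p.2 0 ≠ 1} :=
    (contDiff_const.sub (contDiff_const.mul h0)).contDiffOn.inv
      fun p hp h ↦ hp (by linarith)
  exact h1.smul contDiff_swapCoord.contDiffOn

theorem contDiff_halfStereoInv : ContDiff ℝ ∞ (halfStereoInv b s) := by
  have hc (i : Fin n) : ContDiff ℝ ∞ fun w : EuclideanSpace ℝ (Fin n) ↦ w i :=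
    contDiff_euclidean.1 contDiff_id i
  have h0 : ContDiff ℝ ∞ fun w : EuclideanSpace ℝ (Fin n) ↦ ‖w‖ ^ 2 := contDiff_norm_sq ℝ
  have h1 : ContDiff ℝ ∞ fun w : EuclideanSpace ℝ (Fin n) ↦ (‖w‖ ^ 2 + 1)⁻¹ :=
    (h0.add contDiff_const).inv fun w ↦ by positivity
  have h2 : ContDiff ℝ ∞ fun w : EuclideanSpace ℝ (Fin n) ↦ 2 * w 0 :=
    contDiff_const.mul (hc 0)
  refine h1.smul (h2.prodMk (b.repr.symm.contDiff.comp ?_))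
  rw [contDiff_euclidean]
  intro i
  by_cases hi : i = 0
  · simp only [hi, if_true]
    exact contDiff_const.mul (h0.sub contDiff_const)
  · simp only [hi, if_false]
    exact contDiff_const.mul (hc i)

variable (b s)

/-- Stereographic projection of the half-sphere from `(0, s • b 0)`, `s = ±1`, as a chart with
values in `ℝⁿ_1`. -/
def halfSphereChart (hs : s * s = 1) : OpenPartialHomeomorph (HalfSphere X) (Orthant n 1) where
  toFun p := ⟨halfStereo b s p.1, fun i hi ↦ by
    have hi : i = 0 := Fin.ext (by simpa using hi)
    have := one_sub_repr_nonneg (b := b) hs p.2.1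
    have := p.2.2
    simp only [halfStereo, swapCoord, hi, PiLp.smul_apply, if_true, smul_eq_mul]
    positivity⟩
  invFun w := ⟨halfStereoInv b s w.1, halfStereoInv_mem hs w.1, by
    have : 0 ≤ w.1 0 := w.2 0 (by simp)
    simp only [halfStereoInv, Prod.smul_mk, smul_eq_mul]
    positivity⟩
  source := {p | s * b.repr p.1.2 0 ≠ 1}
  target := univ
  map_source' _ _ := mem_univ _
  map_target' w _ := halfStereoInv_ne hs w.1
  left_inv' p hp := Subtype.ext (halfStereoInv_halfStereo hs p.2.1 hp)
  right_inv' w _ := Subtype.ext (halfStereo_halfStereoInv hs w.1)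
  open_source := by
    apply isOpen_ne_fun <;> fun_prop
  open_target := isOpen_univ
  continuousOn_toFun := by
    refine Topology.IsInducing.subtypeVal.continuousOn_iff.2 ?_
    exact contDiffOn_halfStereo.continuousOn.comp continuous_subtype_val.continuousOn
      fun p hp ↦ hp
  continuousOn_invFun := (Continuous.subtype_mk
    (contDiff_halfStereoInv.continuous.comp continuous_subtype_val) _).continuousOn

variable (X) in
theorem neZero_finrank [FiniteDimensional ℝ X] [Nontrivial X] : NeZero (finrank ℝ X) :=
  NeZero.of_pos finrank_pos

attribute [local instance] neZero_finrank

variable [FiniteDimensional ℝ X] [Nontrivial X]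

instance : ChartedSpace (Orthant (finrank ℝ X) 1) (HalfSphere X) where
  atlas := {φ | ∃ (s : ℝ) (hs : s * s = 1), φ = halfSphereChart (stdOrthonormalBasis ℝ X) s hs}
  chartAt p := if (stdOrthonormalBasis ℝ X).repr p.1.2 0 ≤ 0
    then halfSphereChart (stdOrthonormalBasis ℝ X) 1 (by norm_num)
    else halfSphereChart (stdOrthonormalBasis ℝ X) (-1) (by norm_num)
  mem_chart_source p := by
    split_ifs with h
    · change 1 * _ ≠ (1 : ℝ)
      linarith
    · change -1 * _ ≠ (1 : ℝ)
      linarith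
  chart_mem_atlas p := by
    split_ifs
    · exact ⟨1, _, rfl⟩
    · exact ⟨-1, _, rfl⟩

instance : IsManifold (orthantModel (finrank ℝ X) 1) ∞ (HalfSphere X) :=
  isManifold_of_contDiffOn _ _ _ (by
    rintro _ _ ⟨s, hs, rfl⟩ ⟨s', hs', rfl⟩
    set b := stdOrthonormalBasis ℝ X
    have key : ContDiffOn ℝ ∞ (halfStereo b s' ∘ halfStereoInv b s)
        {w | s' * b.repr (halfStereoInv b s w).2 0 ≠ 1} :=
      contDiffOn_halfStereo.comp contDiff_halfStereoInv.contDiffOn fun w hw ↦ hw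
    refine (key.mono ?_).congr ?_
    · rintro w ⟨hw, w, rfl⟩
      have := hw.2
      simpa using! this
    · rintro w ⟨hw, w, rfl⟩
      simp only [Function.comp_apply, ModelWithCorners.left_inv]
      rfl)

end HalfSphere

/-! ### The spherical compactification -/

/-- The spherical compactification `X̄ = X ⊔ 𝕊_X`, where `𝕊_X` is the set of rays of `X`
emanating from `0`. -/
inductive SphericalCompactification (X : Type*) [AddCommGroup X] [Module ℝ X]
  /-- a point of `X` -/
  | ofPoint (x : X) : SphericalCompactification X
  /-- a point at infinity, that is, a ray `ℝ₊v` -/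
  | ofRay (r : Module.Ray ℝ X) : SphericalCompactification X

namespace SphericalCompactification

section Sets

variable {X : Type*} [AddCommGroup X] [Module ℝ X]

/-- The sphere at infinity `𝕊_Y ⊆ 𝕊_X ⊆ X̄` of a linear subspace `Y`: the set of the rays
contained in `Y`. -/
def sphereAtInfinity (Y : Submodule ℝ X) : Set (SphericalCompactification X) :=
  {q | ∃ (v : X) (hv : v ≠ 0), v ∈ Y ∧ q = ofRay (rayOfNeZero ℝ v hv)}

/-- The spherical compactification `Ȳ = Y ⊔ 𝕊_Y` of a linear subspace `Y`, as a subset of `X̄`. -/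
def compactification (Y : Submodule ℝ X) : Set (SphericalCompactification X) :=
  ofPoint '' (Y : Set X) ∪ sphereAtInfinity Y

/-- The family `F̄ = {Ȳ | Y ∈ F}`. -/
def compactifications (F : Set (Submodule ℝ X)) : Set (Set (SphericalCompactification X)) :=
  compactification '' F

/-- The family `𝕊_F = {𝕊_Y | Y ∈ F}`. -/
def spheresAtInfinity (F : Set (Submodule ℝ X)) : Set (Set (SphericalCompactification X)) :=
  sphereAtInfinity '' F

end Sets

variable {X : Type*} [NormedAddCommGroup X] [InnerProductSpace ℝ X]

/-- The map `Θ : X̄ → {(t, x) ∈ ℝ × X | t² + ‖x‖² = 1, t ≥ 0}` with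
`Θ(x) = (1 + ‖x‖²)^{-1/2} (1, x)` and `Θ(ℝ₊v) = ‖v‖⁻¹ (0, v)`. -/
def theta : SphericalCompactification X → HalfSphere X
  | ofPoint x => ⟨(√(1 + ‖x‖ ^ 2))⁻¹ • ((1 : ℝ), x), by
      have h : (0 : ℝ) < 1 + ‖x‖ ^ 2 := by positivity
      simp only [Prod.smul_mk, smul_eq_mul, mul_one, norm_smul, norm_inv, Real.norm_eq_abs,
        mul_pow, inv_pow, sq_abs, Real.sq_sqrt h.le]
      field_simp, by
      simp only [Prod.smul_mk, smul_eq_mul]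
      positivity⟩
  | ofRay r => ⟨‖r.someVector‖⁻¹ • ((0 : ℝ), r.someVector), by
      have h : ‖r.someVector‖ ≠ 0 := norm_ne_zero_iff.2 r.someVector_ne_zero
      simp [norm_smul, h], by simp⟩

/-- The value `Θ(ℝ₊v) = ‖v‖⁻¹ (0, v)` does not depend on the vector `v` spanning the ray. -/
theorem theta_ofRay (v : X) (hv : v ≠ 0) :
    (theta (ofRay (rayOfNeZero ℝ v hv))).1 = ‖v‖⁻¹ • ((0 : ℝ), v) := by
  set r := rayOfNeZero ℝ v hv with hr
  have h : SameRay ℝ r.someVector v := by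
    rw [← ray_eq_iff r.someVector_ne_zero hv, r.someVector_ray]
  have := (sameRay_iff_inv_norm_smul_eq_of_ne r.someVector_ne_zero hv).1 h
  simp only [theta, Prod.smul_mk, this, smul_zero]

/-- The inverse `Θ⁻¹` of `Θ`. -/
def thetaInv (p : HalfSphere X) : SphericalCompactification X :=
  open Classical in
  if h : p.1.1 = 0 then ofRay (rayOfNeZero ℝ p.1.2 (by
    intro h'
    have := p.2.1
    simp [h, h'] at this))
  else ofPoint (p.1.1⁻¹ • p.1.2)

variable (X) in
/-- The bijection `Θ` from `X̄` to the half-sphere. -/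
def thetaEquiv : SphericalCompactification X ≃ HalfSphere X where
  toFun := theta
  invFun := thetaInv
  left_inv q := by
    cases q with
    | ofPoint x =>
      have h : (0 : ℝ) < √(1 + ‖x‖ ^ 2) := by positivity
      simp [thetaInv, theta, h.ne', smul_smul]
    | ofRay r =>
      have h : 0 < ‖r.someVector‖⁻¹ := inv_pos.2 (norm_pos_iff.2 r.someVector_ne_zero)
      simp only [thetaInv, theta, Prod.smul_mk, smul_zero, dite_true]
      congr 1
      conv_rhs => rw [← r.someVector_ray]
      rw [ray_eq_iff]
      exact SameRay.sameRay_pos_smul_left _ h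
  right_inv p := by
    apply Subtype.ext
    have hp := p.2.1
    by_cases h : p.1.1 = 0
    · simp only [thetaInv, h, dite_true]
      rw [theta_ofRay]
      rw [h] at hp
      have h1 : ‖p.1.2‖ = 1 := by
        rw [← sq_eq_sq₀ (norm_nonneg _) zero_le_one]
        linarith
      simp only [h1, inv_one, one_smul]
      exact Prod.ext h.symm rfl
    · have hpos : 0 < p.1.1 := lt_of_le_of_ne p.2.2 (Ne.symm h)
      have h1 : 1 + ‖p.1.1⁻¹ • p.1.2‖ ^ 2 = (p.1.1⁻¹) ^ 2 := by
        rw [norm_smul, mul_pow, Real.norm_eq_abs, sq_abs]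
        field_simp
        linarith
      simp only [thetaInv, h, dite_false, theta, h1]
      rw [Real.sqrt_sq (inv_pos.2 hpos).le, inv_inv]
      refine Prod.ext ?_ ?_
      · simp
      · simp [smul_smul, h]

/-- The topology on `X̄` for which `Θ` is a homeomorphism. -/
instance : TopologicalSpace (SphericalCompactification X) :=
  TopologicalSpace.induced (thetaEquiv X) inferInstance

variable (X) in
/-- The homeomorphism `Θ`. -/
def thetaHomeomorph : SphericalCompactification X ≃ₜ HalfSphere X :=
  (thetaEquiv X).toHomeomorphOfIsInducing ⟨rfl⟩

/-- The subset `Ȳ` is the closure of `Y` in `X̄`. -/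
theorem closure_image_ofPoint [FiniteDimensional ℝ X] (Y : Submodule ℝ X) :
    closure (ofPoint '' (Y : Set X)) = compactification Y := by
  have hpre : compactification Y = (fun q : SphericalCompactification X ↦ (theta q).1.2) ⁻¹' Y := by
    ext q
    cases q with
    | ofPoint x =>
      have h : (√(1 + ‖x‖ ^ 2))⁻¹ ≠ 0 := by positivity
      simp [compactification, sphereAtInfinity, theta, Y.smul_mem_iff h]
    | ofRay r =>
      induction r using Module.Ray.ind with
      | h v hv =>
      have hn : ‖v‖⁻¹ ≠ 0 := inv_ne_zero (norm_ne_zero_iff.2 hv)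
      simp only [compactification, sphereAtInfinity, mem_union, mem_image, reduceCtorEq, and_false,
        exists_false, false_or, mem_preimage, theta_ofRay, Prod.smul_mk, SetLike.mem_coe,
        Y.smul_mem_iff hn, mem_ofPred_eq, ofRay.injEq]
      constructor
      · rintro ⟨u, hu, huY, h⟩
        obtain ⟨a, -, ha⟩ := ((ray_eq_iff hv hu).1 h).symm.exists_pos_left hu hv
        rw [← ha]
        exact Y.smul_mem _ huY
      · intro h
        exact ⟨v, hv, h, rfl⟩
  have hcont : Continuous (theta : SphericalCompactification X → HalfSphere X) :=
    (thetaHomeomorph X).continuous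
  apply subset_antisymm
  · refine closure_minimal (t := compactification Y) subset_union_left ?_
    rw [hpre]
    exact Y.closed_of_finiteDimensional.preimage
      (continuous_snd.comp (continuous_subtype_val.comp hcont))
  · rintro q (hq | ⟨v, hv, hvY, rfl⟩)
    · exact subset_closure hq
    · have hlim : Filter.Tendsto (fun t : ℝ ↦ (ofPoint (t • v) : SphericalCompactification X))
          Filter.atTop (nhds (ofRay (rayOfNeZero ℝ v hv))) := by
        rw [(thetaHomeomorph X).isInducing.tendsto_nhds_iff, tendsto_subtype_rng]
        change Filter.Tendsto (fun t : ℝ ↦ (theta (ofPoint (t • v))).1) _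
          (nhds (theta (ofRay (rayOfNeZero ℝ v hv))).1)
        rw [theta_ofRay]
        have hg : ContinuousAt (fun e : ℝ ↦ (√(e ^ 2 + ‖v‖ ^ 2))⁻¹ • (e, v)) 0 := by
          have : √((0 : ℝ) ^ 2 + ‖v‖ ^ 2) ≠ 0 := by
            have := norm_pos_iff.2 hv
            positivity
          fun_prop (disch := assumption)
        have hg' := hg.tendsto.comp tendsto_inv_atTop_zero
        simp only [ne_eq, OfNat.ofNat_ne_zero, not_false_eq_true, zero_pow, zero_add,
          Real.sqrt_sq (norm_nonneg v)] at hg'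
        refine hg'.congr' ?_
        filter_upwards [Filter.eventually_gt_atTop 0] with t ht
        have h1 : 1 + ‖t • v‖ ^ 2 = t ^ 2 * (t⁻¹ ^ 2 + ‖v‖ ^ 2) := by
          rw [norm_smul, mul_pow, Real.norm_eq_abs, sq_abs]
          field_simp
        simp only [Function.comp_apply, theta, h1]
        rw [Real.sqrt_mul (sq_nonneg t), Real.sqrt_sq ht.le, mul_inv]
        refine Prod.ext ?_ ?_
        · simp [mul_comm]
        · simp only [Prod.smul_mk, smul_smul]
          congr 1
          field_simp
      exact mem_closure_of_tendsto hlim (Filter.Eventually.of_forall fun t ↦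
        ⟨t • v, Y.smul_mem _ hvY, rfl⟩)

variable [FiniteDimensional ℝ X] [Nontrivial X]

/-- The smooth structure on `X̄` for which `Θ` is a diffeomorphism: its charts are those of the
half-sphere composed with `Θ`. -/
instance : ChartedSpace (Orthant (finrank ℝ X) 1) (SphericalCompactification X) where
  atlas := {φ | ∃ ψ ∈ atlas (Orthant (finrank ℝ X) 1) (HalfSphere X),
    φ = (thetaHomeomorph X).transOpenPartialHomeomorph ψ}
  chartAt q := (thetaHomeomorph X).transOpenPartialHomeomorph (chartAt _ (thetaHomeomorph X q))
  mem_chart_source q := mem_chart_source _ (thetaHomeomorph X q)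
  chart_mem_atlas _ := ⟨_, chart_mem_atlas _ _, rfl⟩

/-- The compactification `X̄` is a smooth manifold with boundary. -/
instance : IsManifold (orthantModel (finrank ℝ X) 1) ∞ (SphericalCompactification X) where
  compatible := by
    rintro _ _ ⟨ψ, hψ, rfl⟩ ⟨ψ', hψ', rfl⟩
    have h := HasGroupoid.compatible (G := contDiffGroupoid ∞ (orthantModel (finrank ℝ X) 1)) hψ hψ'
    convert! h using 1
    ext x
    · simp
    · simp
    · simp

end SphericalCompactification

end

/-!
`Θ` embeds `X̄` smoothly into the unit sphere of the euclidean space `ℝ × X`, and `Ȳ`, `𝕊_Y` are the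
traces on the half-sphere of the linear subspaces `ℝ × Y` and `0 × Y`.

For every linear subspace `W` the tangent space of `Θ⁻¹(W)` at `q` is `dΘ_q⁻¹(W)`: a vector of
`dΘ_q⁻¹(W)` or its opposite points into the half-sphere, where it is the velocity of the radial
projection of a half-line contained in `W`. Cleanness thus reduces to the fact that preimages of
subspaces commute with intersections.

For `Y ≠ 0` choose an orthonormal basis of `X` adapted to `Y` with `b 0 ∈ Y`. The stereographic
projections from `(0, ±b 0)`, which lie in every subspace involved, send `Ȳ` and `𝕊_Y` to coordinate
faces. For `Y = 0` there is no such pole, but then `𝕊_Y` is empty and `Ȳ` is an interior point.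
-/

open Set Module
open scoped Manifold ContDiff

section Calculus

variable {𝕜 : Type*} [NontriviallyNormedField 𝕜]
  {E : Type*} [NormedAddCommGroup E] [NormedSpace 𝕜 E] {H : Type*} [TopologicalSpace H]
  {I : ModelWithCorners 𝕜 E H} {M : Type*} [TopologicalSpace M] [ChartedSpace H M]

theorem contMDiffOn_model_comp_iff {E' : Type*} [NormedAddCommGroup E'] [NormedSpace 𝕜 E']
    {H' : Type*} [TopologicalSpace H'] (J : ModelWithCorners 𝕜 E' H') {f : M → H'} {s : Set M}
    {m : WithTop ℕ∞} :
    ContMDiffOn I 𝓘(𝕜, E') m (J ∘ f) s ↔ ContMDiffOn I J m f s := by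
  refine ⟨fun hf ↦ ?_, J.contMDiff.comp_contMDiffOn⟩
  refine (J.contMDiffOn_symm.comp hf fun x _ ↦ mem_range_self (f x)).congr fun x _ ↦ ?_
  exact (J.left_inv (f x)).symm

theorem mfderiv_mfderivWithin_one {F : Type*} [NormedAddCommGroup F] [NormedSpace 𝕜 F]
    {f : M → F} {γ : 𝕜 → M} {s : Set 𝕜} {t : 𝕜}
    (hf : MDifferentiableAt I 𝓘(𝕜, F) f (γ t)) (hγ : MDifferentiableWithinAt 𝓘(𝕜, 𝕜) I γ s t)
    (hs : UniqueDiffWithinAt 𝕜 s t) :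
    mfderiv I 𝓘(𝕜, F) f (γ t) (mfderivWithin 𝓘(𝕜, 𝕜) I γ s t (1 : 𝕜)) =
      derivWithin (f ∘ γ) s t := by
  rw [← fderivWithin_derivWithin, ← mfderivWithin_eq_fderivWithin,
    mfderiv_comp_mfderivWithin t hf hγ hs.uniqueMDiffWithinAt]
  rfl

end Calculus

section UnitSphere

variable {E : Type*} [NormedAddCommGroup E] [InnerProductSpace ℝ E]

theorem inner_mfderiv_eq_zero_of_norm_eq {E' : Type*} [NormedAddCommGroup E'] [NormedSpace ℝ E']
    {H : Type*} [TopologicalSpace H] {I : ModelWithCorners ℝ E' H} {M : Type*}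
    [TopologicalSpace M] [ChartedSpace H M] {f : M → E} {x : M} {c : ℝ}
    (hf : MDifferentiableAt I 𝓘(ℝ, E) f x) (hc : ∀ y, ‖f y‖ = c) (v : TangentSpace I x) :
    inner ℝ (f x) (mfderiv I 𝓘(ℝ, E) f x v : E) = 0 := by
  have hsq : HasFDerivAt (fun p : E ↦ ‖p‖ ^ 2) (2 • innerSL ℝ (f x)) (f x) :=
    (hasStrictFDerivAt_norm_sq (f x)).hasFDerivAt
  have hconst : (fun p : E ↦ ‖p‖ ^ 2) ∘ f = fun _ ↦ c ^ 2 := funext fun y ↦ by simp [hc y]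
  have hcomp := mfderiv_comp x hsq.hasMFDerivAt.mdifferentiableAt hf
  rw [hconst, mfderiv_const, hsq.hasMFDerivAt.mfderiv] at hcomp
  have hv : (0 : ℝ) = (2 : ℕ) • inner ℝ (f x) (mfderiv I 𝓘(ℝ, E) f x v : E) :=
    DFunLike.congr_fun hcomp v
  simpa using hv.symm

/-- The radial projection to the unit sphere of the line `r ↦ p + r • w`; if `p` is a unit vector
orthogonal to `w`, this is a curve on the sphere with initial velocity `w`. -/
noncomputable def normalizedLine (p w : E) (r : ℝ) : E := ‖p + r • w‖⁻¹ • (p + r • w)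

variable {p w : E}

theorem norm_add_smul_pos (hp : ‖p‖ = 1) (hpw : inner ℝ p w = 0) (r : ℝ) : 0 < ‖p + r • w‖ := by
  rw [norm_pos_iff]
  intro h
  have : inner ℝ p (p + r • w) = 1 := by
    rw [inner_add_right, inner_smul_right, hpw, real_inner_self_eq_norm_sq, hp]
    norm_num
  simp [h] at this

theorem norm_normalizedLine (hp : ‖p‖ = 1) (hpw : inner ℝ p w = 0) (r : ℝ) :
    ‖normalizedLine p w r‖ = 1 := by
  rw [normalizedLine, norm_smul, norm_inv, norm_norm,
    inv_mul_cancel₀ (norm_add_smul_pos hp hpw r).ne']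

theorem normalizedLine_zero (hp : ‖p‖ = 1) : normalizedLine p w 0 = p := by
  simp [normalizedLine, hp]

theorem normalizedLine_mem {W : Submodule ℝ E} (hp : p ∈ W) (hw : w ∈ W) (r : ℝ) :
    normalizedLine p w r ∈ W :=
  W.smul_mem _ (W.add_mem hp (W.smul_mem _ hw))

theorem contDiff_normalizedLine {n : WithTop ℕ∞} (hp : ‖p‖ = 1) (hpw : inner ℝ p w = 0) :
    ContDiff ℝ n (normalizedLine p w) := by
  have hline : ContDiff ℝ n fun r : ℝ ↦ p + r • w := by fun_prop
  have hpos := norm_add_smul_pos hp hpw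
  exact ((hline.norm ℝ fun r ↦ norm_pos_iff.1 (hpos r)).inv fun r ↦ (hpos r).ne').smul hline

theorem hasDerivAt_normalizedLine_zero (hp : ‖p‖ = 1) (hpw : inner ℝ p w = 0) :
    HasDerivAt (normalizedLine p w) w 0 := by
  have hline : HasDerivAt (fun r : ℝ ↦ p + r • w) w 0 := by
    simpa using ((hasDerivAt_id (0 : ℝ)).smul_const w).const_add p
  have hnorm : HasDerivAt (fun r : ℝ ↦ ‖p + r • w‖) 0 0 := by
    have hsqrt := hline.norm_sq.sqrt (by simp [hp])
    simpa [hpw, Real.sqrt_sq (norm_nonneg _)] using hsqrt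
  exact ((hnorm.inv (by simp [hp])).smul hline).congr_deriv (by simp [hp])

end UnitSphere

section OrthonormalBasis

variable {𝕜 E ι : Type*} [RCLike 𝕜] [NormedAddCommGroup E] [InnerProductSpace 𝕜 E]

theorem exists_orthonormalBasis_mem_or_mem_orthogonal [FiniteDimensional 𝕜 E]
    (Y : Submodule 𝕜 E) :
    ∃ b : OrthonormalBasis (Fin (finrank 𝕜 E)) 𝕜 E, ∀ i, b i ∈ Y ∨ b i ∈ Yᗮ := by
  have hV : DirectSum.IsInternal fun i : Bool ↦ cond i Y Yᗮ :=
    (DirectSum.isInternal_submodule_iff_isCompl _ (i := true) (j := false) (by simp)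
      (by ext i; cases i <;> simp)).2 Y.isCompl_orthogonal
  refine ⟨hV.subordinateOrthonormalBasis rfl Y.orthogonalFamily_self, fun i ↦ ?_⟩
  have hi := hV.subordinateOrthonormalBasis_subordinate rfl i Y.orthogonalFamily_self
  cases h : hV.subordinateOrthonormalBasisIndex rfl i Y.orthogonalFamily_self <;> rw [h] at hi
  exacts [Or.inr hi, Or.inl hi]

theorem mem_iff_orthonormalBasis_repr_eq_zero [Fintype ι] (b : OrthonormalBasis ι 𝕜 E)
    {Y : Submodule 𝕜 E} (hb : ∀ i, b i ∈ Y ∨ b i ∈ Yᗮ) {x : E} :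
    x ∈ Y ↔ ∀ i, b i ∉ Y → b.repr x i = 0 := by
  refine ⟨fun hx i hi ↦ ?_, fun hx ↦ ?_⟩
  · rw [b.repr_apply_apply]
    exact Submodule.inner_left_of_mem_orthogonal hx ((hb i).resolve_left hi)
  · rw [← b.sum_repr x]
    refine Y.sum_mem fun i _ ↦ ?_
    by_cases hi : b i ∈ Y
    · exact Y.smul_mem _ hi
    · simp [hx i hi]

theorem exists_orthonormalBasis_zero_mem [FiniteDimensional 𝕜 E] [NeZero (finrank 𝕜 E)]
    {Y : Submodule 𝕜 E} (hY : Y ≠ ⊥) :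
    ∃ b : OrthonormalBasis (Fin (finrank 𝕜 E)) 𝕜 E, b 0 ∈ Y ∧ ∀ i, b i ∈ Y ∨ b i ∈ Yᗮ := by
  obtain ⟨b, hb⟩ := exists_orthonormalBasis_mem_or_mem_orthogonal Y
  obtain ⟨i, hi⟩ : ∃ i, b i ∈ Y := by
    by_contra! hnot
    refine hY (Y.eq_bot_iff.2 fun x hx ↦ b.repr.map_eq_zero_iff.1 ?_)
    ext i
    exact (mem_iff_orthonormalBasis_repr_eq_zero b hb).1 hx i (hnot i)
  exact ⟨b.reindex (Equiv.swap 0 i), by simpa using hi, fun j ↦ by simpa using hb _⟩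

end OrthonormalBasis

section Corners

theorem mem_interior_range_orthantModel {n k : ℕ} {w : EuclideanSpace ℝ (Fin n)}
    (hw : ∀ i : Fin n, (i : ℕ) < k → 0 < w i) : w ∈ interior (range (orthantModel n k)) := by
  have hopen : IsOpen {w : EuclideanSpace ℝ (Fin n) | ∀ i : Fin n, (i : ℕ) < k → 0 < w i} := by
    simp only [ofPred_forall]
    exact isOpen_iInter_of_finite fun i ↦ isOpen_iInter_of_finite fun _ ↦
      isOpen_lt continuous_const (by fun_prop)
  refine interior_maximal (fun v hv ↦ ?_) hopen hw
  exact ⟨⟨v, fun i hi ↦ (hv i hi).le⟩, rfl⟩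

variable {n : ℕ} {H : Type*} [TopologicalSpace H]
  {I : ModelWithCorners ℝ (EuclideanSpace ℝ (Fin n)) H}
  {M : Type*} [TopologicalSpace M] [ChartedSpace H M] {P : Set M} {x : M}

theorem isPSubmanifold_of_isImage
    (h : ∀ x ∈ P, ∃ k ≤ n, ∃ (φ : OpenPartialHomeomorph M (Orthant n k)) (J : Finset (Fin n)),
      IsCornerChart I φ ∧ x ∈ φ.source ∧ φ.IsImage P (orthantFace J)) :
    IsPSubmanifold I P := by
  intro x hx
  obtain ⟨k, hk, φ, J, hφ, hxφ, hJ⟩ := h x hx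
  refine ⟨k, hk, φ, J, hφ, hxφ, ?_⟩
  rw [inter_comm, hJ.image_eq, inter_comm]

variable (I) in
/-- The chart of `M` around an interior point `x` with values in `ℝⁿ = ℝⁿ_0`: the preferred chart,
restricted to the preimage of the interior of its range and translated so that `x` goes to `0`. -/
noncomputable def interiorChart (x : M) : OpenPartialHomeomorph M (Orthant n 0) where
  toFun y := ⟨extChartAt I x y - extChartAt I x x, fun _ h ↦ absurd h (Nat.not_lt_zero _)⟩
  invFun w := (extChartAt I x).symm (w.1 + extChartAt I x x)
  source := (extChartAt I x).source ∩ extChartAt I x ⁻¹' interior (extChartAt I x).target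
  target := {w | w.1 + extChartAt I x x ∈ interior (extChartAt I x).target}
  map_source' y hy := by simpa using hy.2
  map_target' w hw := by
    have hw' := interior_subset hw
    exact ⟨(extChartAt I x).map_target hw', by rwa [mem_preimage, (extChartAt I x).right_inv hw']⟩
  left_inv' y hy := by rw [sub_add_cancel, (extChartAt I x).left_inv hy.1]
  right_inv' w hw := Subtype.ext (by
    rw [(extChartAt I x).right_inv (interior_subset hw), add_sub_cancel_right])
  open_source := (continuousOn_extChartAt x).isOpen_inter_preimage (isOpen_extChartAt_source x)
    isOpen_interior
  open_target := isOpen_interior.preimage (by fun_prop)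
  continuousOn_toFun := Topology.IsInducing.subtypeVal.continuousOn_iff.2
    (((continuousOn_extChartAt x).mono inter_subset_left).sub continuousOn_const)
  continuousOn_invFun := (continuousOn_extChartAt_symm x).comp (by fun_prop)
    fun _ hw ↦ interior_subset hw

theorem isCornerChart_interiorChart [IsManifold I ∞ M] (x : M) :
    IsCornerChart I (interiorChart I x) where
  contMDiffOn := (contMDiffOn_model_comp_iff (orthantModel n 0)).1
    ((contMDiffOn_extChartAt.mono fun _ hy ↦ by simpa using hy.1).sub contMDiffOn_const)
  contMDiffOn_symm := (contMDiffOn_extChartAt_symm x).comp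
    ((orthantModel n 0).contMDiff.add contMDiff_const).contMDiffOn
    fun _ hw ↦ interior_subset (s := (extChartAt I x).target) hw

theorem isPSubmanifold_singleton [IsManifold I ∞ M] (hx : I.IsInteriorPoint x) :
    IsPSubmanifold I {x} := by
  have hsource : x ∈ (interiorChart I x).source :=
    ⟨mem_extChartAt_source x, ModelWithCorners.isInteriorPoint_iff.1 hx⟩
  have hzero (y : M) : interiorChart I x y ∈ orthantFace Finset.univ ↔
      extChartAt I x y - extChartAt I x x = 0 := by
    simp only [orthantFace, mem_ofPred_eq, Finset.mem_univ, forall_const, WithLp.ext_iff,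
      funext_iff]
    rfl
  refine isPSubmanifold_of_isImage fun y hy ↦ ⟨0, Nat.zero_le _, interiorChart I x, Finset.univ,
    isCornerChart_interiorChart x, mem_singleton_iff.1 hy ▸ hsource, fun z hz ↦ ?_⟩
  rw [hzero, sub_eq_zero, (extChartAt I x).injOn.eq_iff hz.1 hsource.1, mem_singleton_iff]

theorem tangentSubspace_le_comap_mfderiv {F : Type*} [NormedAddCommGroup F] [NormedSpace ℝ F]
    {f : M → F} (hf : MDifferentiableAt I 𝓘(ℝ, F) f x) {W : Submodule ℝ F}
    (hW : IsClosed (W : Set F)) (hP : MapsTo f P W) :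
    tangentSubspace I P x ≤ W.comap (mfderiv I 𝓘(ℝ, F) f x).toLinearMap := by
  refine Submodule.span_le.2 ?_
  rintro _ ⟨γ, ε, rfl, hε, hγ, hγP, rfl⟩
  have h0 : (0 : ℝ) ∈ Ico 0 ε := ⟨le_rfl, hε⟩
  change mfderiv I 𝓘(ℝ, F) f (γ 0) _ ∈ W
  rw [mfderiv_mfderivWithin_one hf ((hγ 0 h0).mdifferentiableWithinAt (by simp))
    (uniqueDiffOn_Ico 0 ε 0 h0)]
  have hspan : Submodule.span ℝ (f ∘ γ '' Ico 0 ε) ≤ W :=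
    Submodule.span_le.2 (image_subset_iff.2 (hP.comp hγP))
  exact closure_minimal hspan hW (range_derivWithin_subset_closure_span_image _
    (by simpa using subset_closure) (mem_range_self 0))

end Corners

namespace SphericalCompactification

attribute [local instance] neZero_finrank

section Embed

variable {X : Type*} [NormedAddCommGroup X] [InnerProductSpace ℝ X]
  {q : SphericalCompactification X}

/-- The map `Θ`, seen as an embedding of `X̄` into the euclidean space `ℝ × X`; the `L²` norm turns
the sphere `t² + ‖x‖² = 1` into the unit sphere of an inner product space. -/
noncomputable def embed (q : SphericalCompactification X) : WithLp 2 (ℝ × X) :=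
  WithLp.toLp 2 (theta q).1

theorem embed_injective : Function.Injective (embed : SphericalCompactification X → _) :=
  (WithLp.toLp_injective 2).comp (Subtype.val_injective.comp (thetaEquiv X).injective)

theorem isInducing_embed : Topology.IsInducing (embed : SphericalCompactification X → _) :=
  (WithLp.homeomorphProd 2 ℝ X).symm.isInducing.comp
    (Topology.IsInducing.subtypeVal.comp (thetaHomeomorph X).isInducing)

theorem fst_sq_add_norm_snd_sq_embed (q : SphericalCompactification X) :
    (embed q).fst ^ 2 + ‖(embed q).snd‖ ^ 2 = 1 :=
  (theta q).2.1

theorem norm_embed (q : SphericalCompactification X) : ‖embed q‖ = 1 := by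
  rw [← sq_eq_sq₀ (norm_nonneg _) zero_le_one, WithLp.prod_norm_sq_eq_of_L2, Real.norm_eq_abs,
    sq_abs, fst_sq_add_norm_snd_sq_embed, one_pow]

theorem range_embed :
    range (embed : SphericalCompactification X → _) = {p | ‖p‖ = 1 ∧ 0 ≤ p.fst} := by
  ext p
  refine ⟨?_, fun ⟨hp, hp0⟩ ↦ ?_⟩
  · rintro ⟨q, rfl⟩
    exact ⟨norm_embed q, (theta q).2.2⟩
  · have hsq : p.fst ^ 2 + ‖p.snd‖ ^ 2 = 1 := by
      rw [← sq_abs, ← Real.norm_eq_abs, ← WithLp.prod_norm_sq_eq_of_L2, hp, one_pow]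
    obtain ⟨q, hq⟩ := (thetaEquiv X).surjective ⟨p.ofLp, hsq, hp0⟩
    exact ⟨q, congrArg (fun h : HalfSphere X ↦ WithLp.toLp 2 h.1) hq⟩

theorem mem_compactification_iff {Y : Submodule ℝ X} :
    q ∈ compactification Y ↔ (embed q).snd ∈ Y := by
  cases q with
  | ofPoint x =>
    have h : (√(1 + ‖x‖ ^ 2))⁻¹ ≠ 0 := by positivity
    simp [compactification, sphereAtInfinity, embed, theta, Y.smul_mem_iff h]
  | ofRay r =>
    induction r using Module.Ray.ind with
    | h v hv =>
    have hn : ‖v‖⁻¹ ≠ 0 := inv_ne_zero (norm_ne_zero_iff.2 hv)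
    simp only [compactification, sphereAtInfinity, mem_union, mem_image, reduceCtorEq, and_false,
      exists_false, false_or, embed, theta_ofRay, Prod.smul_mk, WithLp.toLp_snd,
      Y.smul_mem_iff hn, mem_ofPred_eq, ofRay.injEq]
    refine ⟨?_, fun h ↦ ⟨v, hv, h, rfl⟩⟩
    rintro ⟨u, hu, huY, h⟩
    obtain ⟨a, -, rfl⟩ := ((ray_eq_iff hv hu).1 h).symm.exists_pos_left hu hv
    exact Y.smul_mem a huY

theorem mem_sphereAtInfinity_iff {Y : Submodule ℝ X} :
    q ∈ sphereAtInfinity Y ↔ (embed q).fst = 0 ∧ (embed q).snd ∈ Y := by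
  rw [← mem_compactification_iff]
  cases q with
  | ofPoint x =>
    have h : √(1 + ‖x‖ ^ 2) ≠ 0 := by positivity
    simp [sphereAtInfinity, embed, theta, h]
  | ofRay r => simp [compactification, embed, theta]

theorem compactification_eq_preimage_embed (Y : Submodule ℝ X) :
    compactification Y = embed ⁻¹' (Y.comap (WithLp.sndₗ 2 ℝ ℝ X)) :=
  ext fun _ ↦ mem_compactification_iff

theorem sphereAtInfinity_eq_preimage_embed (Y : Submodule ℝ X) :
    sphereAtInfinity Y =
      embed ⁻¹' ((WithLp.fstₗ 2 ℝ ℝ X).ker ⊓ Y.comap (WithLp.sndₗ 2 ℝ ℝ X) : Submodule ℝ _) :=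
  ext fun _ ↦ mem_sphereAtInfinity_iff

theorem compactification_inter_compactification (Y Z : Submodule ℝ X) :
    compactification Y ∩ compactification Z = compactification (Y ⊓ Z) := by
  ext q
  simp only [mem_inter_iff, mem_compactification_iff, Submodule.mem_inf]

theorem sphereAtInfinity_inter_compactification (Y Z : Submodule ℝ X) :
    sphereAtInfinity Y ∩ compactification Z = sphereAtInfinity (Y ⊓ Z) := by
  ext q
  simp only [mem_inter_iff, mem_sphereAtInfinity_iff, mem_compactification_iff, Submodule.mem_inf,
    and_assoc]

theorem sphereAtInfinity_inter_sphereAtInfinity (Y Z : Submodule ℝ X) :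
    sphereAtInfinity Y ∩ sphereAtInfinity Z = sphereAtInfinity (Y ⊓ Z) := by
  ext q
  simp only [mem_inter_iff, mem_sphereAtInfinity_iff, Submodule.mem_inf]
  tauto

theorem sphereAtInfinity_bot : sphereAtInfinity (⊥ : Submodule ℝ X) = ∅ :=
  eq_empty_of_forall_notMem fun _ ⟨_, hv, hv', _⟩ ↦ hv hv'

theorem compactification_bot : compactification (⊥ : Submodule ℝ X) = {ofPoint 0} := by
  simp [compactification, sphereAtInfinity_bot]

end Embed

section Smooth

variable {X : Type*} [NormedAddCommGroup X] [InnerProductSpace ℝ X]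

theorem contDiffAt_halfStereo_ofLp {n : ℕ} [NeZero n] {b : OrthonormalBasis (Fin n) ℝ X} {s : ℝ}
    {p : WithLp 2 (ℝ × X)} (hp : s * b.repr p.snd 0 ≠ 1) :
    ContDiffAt ℝ ∞ (halfStereo b s ∘ WithLp.ofLp) p := by
  have hopen : IsOpen {p : ℝ × X | s * b.repr p.2 0 ≠ 1} := by
    apply isOpen_ne_fun <;> fun_prop
  exact (contDiffOn_halfStereo.contDiffAt (hopen.mem_nhds hp)).comp p
    WithLp.contDiff_ofLp.contDiffAt

variable [FiniteDimensional ℝ X] [Nontrivial X] {q : SphericalCompactification X}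

theorem exists_extChartAt_eq_halfStereo (q : SphericalCompactification X) :
    ∃ s : ℝ, s * s = 1 ∧
      (extChartAt (orthantModel (finrank ℝ X) 1) q).source =
        {q' | s * (stdOrthonormalBasis ℝ X).repr (embed q').snd 0 ≠ 1} ∧
      ⇑(extChartAt (orthantModel (finrank ℝ X) 1) q) =
        (halfStereo (stdOrthonormalBasis ℝ X) s ∘ WithLp.ofLp) ∘ embed := by
  obtain ⟨s, hs, h⟩ := chart_mem_atlas (Orthant (finrank ℝ X) 1) (thetaHomeomorph X q)
  have hq : chartAt (Orthant (finrank ℝ X) 1) q =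
      (thetaHomeomorph X).transOpenPartialHomeomorph (halfSphereChart _ s hs) :=
    congrArg (thetaHomeomorph X).transOpenPartialHomeomorph h
  refine ⟨s, hs, ?_, ?_⟩
  · rw [extChartAt_source, hq]
    rfl
  · rw [extChartAt_coe, hq]
    rfl

theorem contMDiff_embed :
    ContMDiff (orthantModel (finrank ℝ X) 1) 𝓘(ℝ, WithLp 2 (ℝ × X)) ∞ (embed (X := X)) := by
  intro q
  obtain ⟨s, hs, hsource, hchart⟩ := exists_extChartAt_eq_halfStereo q
  have hinv : ContDiff ℝ ∞ fun w ↦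
      WithLp.toLp 2 (halfStereoInv (stdOrthonormalBasis ℝ X) s w) :=
    WithLp.contDiff_toLp.comp contDiff_halfStereoInv
  refine (hinv.contMDiff.contMDiffAt.comp q (contMDiffAt_extChartAt (x := q))).congr_of_eventuallyEq
    ?_
  filter_upwards [extChartAt_source_mem_nhds (I := orthantModel (finrank ℝ X) 1) q] with q' hq'
  rw [hsource] at hq'
  rw [hchart]
  exact congrArg (WithLp.toLp 2)
    (halfStereoInv_halfStereo hs (fst_sq_add_norm_snd_sq_embed q') hq').symm

theorem contMDiffOn_embed_comp_iff {E H N : Type*} [NormedAddCommGroup E] [NormedSpace ℝ E]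
    [TopologicalSpace H] {J : ModelWithCorners ℝ E H} [TopologicalSpace N] [ChartedSpace H N]
    {f : N → SphericalCompactification X} {t : Set N} :
    ContMDiffOn J 𝓘(ℝ, WithLp 2 (ℝ × X)) ∞ (embed ∘ f) t ↔
      ContMDiffOn J (orthantModel (finrank ℝ X) 1) ∞ f t := by
  refine ⟨fun hf x hx ↦ ?_, contMDiff_embed.comp_contMDiffOn⟩
  rw [contMDiffWithinAt_iff_target]
  refine ⟨isInducing_embed.continuousWithinAt_iff.2 (hf x hx).continuousWithinAt, ?_⟩
  obtain ⟨s, -, hsource, hchart⟩ := exists_extChartAt_eq_halfStereo (f x)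
  have hmem := mem_extChartAt_source (I := orthantModel (finrank ℝ X) 1) (f x)
  rw [hsource] at hmem
  rw [hchart, Function.comp_assoc]
  exact (contDiffAt_halfStereo_ofLp hmem).contMDiffAt.comp_contMDiffWithinAt x (hf x hx)

variable (X) in
/-- The differential of the embedding `Θ` of `X̄` into the euclidean space `ℝ × X`. -/
noncomputable abbrev embedDeriv (q : SphericalCompactification X) :
    TangentSpace (orthantModel (finrank ℝ X) 1) q →L[ℝ] WithLp 2 (ℝ × X) :=
  mfderiv (orthantModel (finrank ℝ X) 1) 𝓘(ℝ, WithLp 2 (ℝ × X)) embed q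

theorem mdifferentiableAt_embed : MDifferentiableAt (orthantModel (finrank ℝ X) 1)
    𝓘(ℝ, WithLp 2 (ℝ × X)) embed q :=
  contMDiff_embed.mdifferentiableAt (by simp)

theorem embedDeriv_injective (q : SphericalCompactification X) :
    Function.Injective (embedDeriv X q) := by
  obtain ⟨s, -, hsource, hchart⟩ := exists_extChartAt_eq_halfStereo q
  have hmem := mem_extChartAt_source (I := orthantModel (finrank ℝ X) 1) q
  have hinj := (isInvertible_mfderiv_extChartAt hmem).injective
  rw [hsource] at hmem
  have hstereo := (contDiffAt_halfStereo_ofLp hmem).contMDiffAt.mdifferentiableAt (by simp)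
  rw [hchart, mfderiv_comp q hstereo mdifferentiableAt_embed] at hinj
  exact Function.Injective.of_comp hinj

theorem mem_inwardTangentVectors_of_curve {S : Set (WithLp 2 (ℝ × X))}
    {v : TangentSpace (orthantModel (finrank ℝ X) 1) q} {c : ℝ → WithLp 2 (ℝ × X)} {ε : ℝ}
    (hε : 0 < ε) (hc : ContDiffOn ℝ ∞ c (Ico 0 ε))
    (hrange : ∀ r ∈ Ico 0 ε, c r ∈ range embed) (hS : MapsTo c (Ico 0 ε) S)
    (hc0 : c 0 = embed q) (hv : HasDerivWithinAt c (embedDeriv X q v) (Ico 0 ε) 0) :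
    v ∈ inwardTangentVectors (orthantModel (finrank ℝ X) 1) (embed ⁻¹' S) q := by
  have : Nonempty (SphericalCompactification X) := ⟨q⟩
  choose! γ hγ using hrange
  have h0 : (0 : ℝ) ∈ Ico 0 ε := ⟨le_rfl, hε⟩
  obtain rfl : γ 0 = q := embed_injective ((hγ 0 h0).trans hc0)
  have hsmooth := contMDiffOn_embed_comp_iff.1 (hc.congr hγ).contMDiffOn
  have huniq : UniqueDiffWithinAt ℝ (Ico 0 ε) 0 := uniqueDiffOn_Ico 0 ε 0 h0
  refine ⟨γ, ε, rfl, hε, hsmooth, fun r hr ↦ ?_, embedDeriv_injective _ ?_⟩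
  · rw [mem_preimage, hγ r hr]
    exact hS hr
  · refine Eq.trans ?_ (mfderiv_mfderivWithin_one mdifferentiableAt_embed
      ((hsmooth 0 h0).mdifferentiableWithinAt (by simp)) huniq).symm
    exact ((hv.congr_of_mem hγ h0).derivWithin huniq).symm

theorem mem_inwardTangentVectors_preimage_embed {W : Submodule ℝ (WithLp 2 (ℝ × X))}
    (hq : embed q ∈ W) {v : TangentSpace (orthantModel (finrank ℝ X) 1) q}
    (hv : embedDeriv X q v ∈ W) (hnonneg : 0 ≤ (embedDeriv X q v).fst) :
    v ∈ inwardTangentVectors (orthantModel (finrank ℝ X) 1) (embed ⁻¹' W) q := by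
  have horth := inner_mfderiv_eq_zero_of_norm_eq mdifferentiableAt_embed norm_embed v
  have hnorm := norm_embed q
  have hfst : 0 ≤ (embed q).fst := (theta q).2.2
  refine mem_inwardTangentVectors_of_curve one_pos
    (c := normalizedLine (embed q) (embedDeriv X q v))
    (contDiff_normalizedLine hnorm horth).contDiffOn (fun r hr ↦ ?_)
    (fun r _ ↦ normalizedLine_mem hq hv r) (normalizedLine_zero hnorm)
    (hasDerivAt_normalizedLine_zero hnorm horth).hasDerivWithinAt
  have hr0 : 0 ≤ r := hr.1
  rw [range_embed]
  refine ⟨norm_normalizedLine hnorm horth r, ?_⟩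
  simp only [normalizedLine, WithLp.smul_fst, WithLp.add_fst, smul_eq_mul]
  positivity

theorem tangentSubspace_preimage_embed {W : Submodule ℝ (WithLp 2 (ℝ × X))} (hq : embed q ∈ W) :
    tangentSubspace (orthantModel (finrank ℝ X) 1) (embed ⁻¹' W) q =
      W.comap (embedDeriv X q).toLinearMap := by
  refine le_antisymm (tangentSubspace_le_comap_mfderiv mdifferentiableAt_embed
    W.closed_of_finiteDimensional fun _ h ↦ h) fun v hv ↦ ?_
  obtain h | h := le_total 0 (embedDeriv X q v).fst
  · exact Submodule.subset_span (mem_inwardTangentVectors_preimage_embed hq hv h)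
  · rw [← Submodule.neg_mem_iff]
    refine Submodule.subset_span (mem_inwardTangentVectors_preimage_embed hq (v := -v) ?_ ?_)
    · rw [map_neg]
      exact W.neg_mem hv
    · rw [map_neg, WithLp.neg_fst]
      exact neg_nonneg.2 h

end Smooth

section PSubmanifolds

variable {X : Type*} [NormedAddCommGroup X] [InnerProductSpace ℝ X]

theorem snd_mem_iff_swapCoord_eq_zero {n : ℕ} [NeZero n] {b : OrthonormalBasis (Fin n) ℝ X}
    {Y : Submodule ℝ X} (h0 : b 0 ∈ Y) (hb : ∀ i, b i ∈ Y ∨ b i ∈ Yᗮ) {p : ℝ × X} :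
    p.2 ∈ Y ↔ ∀ i, b i ∉ Y → swapCoord b p i = 0 := by
  rw [mem_iff_orthonormalBasis_repr_eq_zero b hb]
  refine forall₂_congr fun i hi ↦ ?_
  have hi0 : i ≠ 0 := fun h ↦ hi (h ▸ h0)
  simp [swapCoord, hi0]

variable [FiniteDimensional ℝ X] [Nontrivial X]

/-- The chart of `X̄` with values in `ℝⁿ_1` given by stereographic projection from the point
`(0, s • b 0)` of the half-sphere, `s = ±1`. -/
noncomputable def stereoChart (b : OrthonormalBasis (Fin (finrank ℝ X)) ℝ X) (s : ℝ)
    (hs : s * s = 1) :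
    OpenPartialHomeomorph (SphericalCompactification X) (Orthant (finrank ℝ X) 1) :=
  (thetaHomeomorph X).transOpenPartialHomeomorph (halfSphereChart b s hs)

variable {b : OrthonormalBasis (Fin (finrank ℝ X)) ℝ X}

theorem isCornerChart_stereoChart {s : ℝ} (hs : s * s = 1) :
    IsCornerChart (orthantModel (finrank ℝ X) 1) (stereoChart b s hs) where
  contMDiffOn := by
    have h : ContMDiffOn (orthantModel (finrank ℝ X) 1) 𝓘(ℝ, EuclideanSpace ℝ (Fin (finrank ℝ X)))
        ∞ ((halfStereo b s ∘ WithLp.ofLp) ∘ embed) (stereoChart b s hs).source :=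
      fun q (hq : s * b.repr (embed q).snd 0 ≠ 1) ↦
        (contDiffAt_halfStereo_ofLp hq).contMDiffAt.comp_contMDiffWithinAt q
          contMDiff_embed.contMDiffAt.contMDiffWithinAt
    exact (contMDiffOn_model_comp_iff (orthantModel _ 1)).1 h
  contMDiffOn_symm := by
    have hinv : ContDiff ℝ ∞ fun w ↦ WithLp.toLp 2 (halfStereoInv b s w) :=
      WithLp.contDiff_toLp.comp contDiff_halfStereoInv
    refine contMDiffOn_embed_comp_iff.1
      ((hinv.contMDiff.comp (orthantModel _ 1).contMDiff).contMDiffOn.congr fun w _ ↦ ?_)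
    exact congrArg (fun p : HalfSphere X ↦ WithLp.toLp 2 p.1)
      ((thetaHomeomorph X).apply_symm_apply _)

theorem isImage_stereoChart {P : Set (SphericalCompactification X)}
    {J : Finset (Fin (finrank ℝ X))}
    (hP : ∀ q, q ∈ P ↔ ∀ i ∈ J, swapCoord b (embed q).ofLp i = 0) {s : ℝ} (hs : s * s = 1) :
    (stereoChart b s hs).IsImage P (orthantFace J) := by
  intro q hq
  have hD : (1 - s * b.repr (embed q).snd 0)⁻¹ ≠ 0 := inv_ne_zero (sub_ne_zero.2 (Ne.symm hq))
  rw [hP]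
  change (∀ i ∈ J, halfStereo b s (embed q).ofLp i = 0) ↔ _
  simp [halfStereo, hD]

theorem isPSubmanifold_of_mem_iff_swapCoord_eq_zero {P : Set (SphericalCompactification X)}
    {J : Finset (Fin (finrank ℝ X))}
    (hP : ∀ q, q ∈ P ↔ ∀ i ∈ J, swapCoord b (embed q).ofLp i = 0) :
    IsPSubmanifold (orthantModel (finrank ℝ X) 1) P := by
  refine isPSubmanifold_of_isImage fun q _ ↦ ?_
  obtain ⟨s, hs, hq⟩ : ∃ s : ℝ, s * s = 1 ∧ s * b.repr (embed q).snd 0 ≠ 1 := by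
    by_cases h : b.repr (embed q).snd 0 ≤ 0
    · exact ⟨1, by norm_num, by linarith⟩
    · exact ⟨-1, by norm_num, by linarith⟩
  exact ⟨1, finrank_pos, stereoChart b s hs, J, isCornerChart_stereoChart hs, hq,
    isImage_stereoChart hP hs⟩

theorem isInteriorPoint_ofPoint (x : X) :
    (orthantModel (finrank ℝ X) 1).IsInteriorPoint (ofPoint x) := by
  obtain ⟨s, hs, hsource, hchart⟩ := exists_extChartAt_eq_halfStereo (ofPoint x)
  have hmem := mem_extChartAt_source (I := orthantModel (finrank ℝ X) 1) (ofPoint x)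
  rw [hsource] at hmem
  have hD : 0 < 1 - s * (stdOrthonormalBasis ℝ X).repr (embed (ofPoint x)).snd 0 :=
    (one_sub_repr_nonneg hs (fst_sq_add_norm_snd_sq_embed _)).lt_of_ne'
      (sub_ne_zero.2 (Ne.symm hmem))
  have hfst : 0 < (embed (ofPoint x)).fst := by
    have h : 0 < (√(1 + ‖x‖ ^ 2))⁻¹ := by positivity
    simpa [embed, theta] using h
  refine mem_interior_range_orthantModel fun i hi ↦ ?_
  obtain rfl : i = 0 := Fin.ext (by simpa using hi)
  rw [hchart]
  simpa [halfStereo, swapCoord] using mul_pos (inv_pos.2 hD) hfst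

theorem isPSubmanifold_compactification (Y : Submodule ℝ X) :
    IsPSubmanifold (orthantModel (finrank ℝ X) 1) (compactification Y) := by
  classical
  obtain rfl | hY := eq_or_ne Y ⊥
  · rw [compactification_bot]
    exact isPSubmanifold_singleton (isInteriorPoint_ofPoint 0)
  obtain ⟨b, h0, hb⟩ := exists_orthonormalBasis_zero_mem hY
  refine isPSubmanifold_of_mem_iff_swapCoord_eq_zero (b := b)
    (J := Finset.univ.filter fun i ↦ b i ∉ Y) fun q ↦ ?_
  simpa using mem_compactification_iff.trans (snd_mem_iff_swapCoord_eq_zero h0 hb)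

theorem isPSubmanifold_sphereAtInfinity (Y : Submodule ℝ X) :
    IsPSubmanifold (orthantModel (finrank ℝ X) 1) (sphereAtInfinity Y) := by
  classical
  obtain rfl | hY := eq_or_ne Y ⊥
  · rw [sphereAtInfinity_bot]
    exact fun _ h ↦ absurd h (notMem_empty _)
  obtain ⟨b, h0, hb⟩ := exists_orthonormalBasis_zero_mem hY
  refine isPSubmanifold_of_mem_iff_swapCoord_eq_zero (b := b)
    (J := insert 0 (Finset.univ.filter fun i ↦ b i ∉ Y)) fun q ↦ ?_
  rw [mem_sphereAtInfinity_iff, Finset.forall_mem_insert]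
  refine and_congr (by simp [swapCoord]) ?_
  simpa using snd_mem_iff_swapCoord_eq_zero h0 hb (p := (embed q).ofLp)

end PSubmanifolds

section Semilattice

variable {X : Type*} [NormedAddCommGroup X] [InnerProductSpace ℝ X] [FiniteDimensional ℝ X]
  [Nontrivial X]

theorem isCleanSemilattice_of_eq_preimage_embed {S : Set (Set (SphericalCompactification X))}
    (hfin : S.Finite) (hS : ∀ P ∈ S, IsPSubmanifold (orthantModel (finrank ℝ X) 1) P)
    (hlin : ∀ P ∈ S, ∃ W : Submodule ℝ (WithLp 2 (ℝ × X)), P = embed ⁻¹' W)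
    (hinter : ∀ P ∈ S, ∀ Q ∈ S, P ∩ Q ∈ S) :
    IsCleanSemilattice (orthantModel (finrank ℝ X) 1) S := by
  refine ⟨hfin, hS, hinter, fun P hP Q hQ ↦
    ⟨hS P hP, hS Q hQ, hS _ (hinter P hP Q hQ), fun q hq ↦ ?_⟩⟩
  obtain ⟨V, rfl⟩ := hlin P hP
  obtain ⟨W, rfl⟩ := hlin Q hQ
  rw [← preimage_inter, ← Submodule.coe_inf, tangentSubspace_preimage_embed hq,
    tangentSubspace_preimage_embed hq.1, tangentSubspace_preimage_embed hq.2, Submodule.comap_inf]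

end Semilattice

end SphericalCompactification

open SphericalCompactification

theorem mainTheorem8_general {X : Type*} [NormedAddCommGroup X] [InnerProductSpace ℝ X]
    [FiniteDimensional ℝ X] [Nontrivial X] {F G : Set (Submodule ℝ X)} (hF : F.Finite)
    (hG : G.Finite) (hFF : ∀ Y ∈ F, ∀ Z ∈ F, Y ⊓ Z ∈ F) (hGG : ∀ Y ∈ G, ∀ Z ∈ G, Y ⊓ Z ∈ G)
    (hFG : ∀ Y ∈ F, ∀ Z ∈ G, Y ⊓ Z ∈ F) :
    IsCleanSemilattice (orthantModel (finrank ℝ X) 1)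
      (spheresAtInfinity F ∪ compactifications G) := by
  refine isCleanSemilattice_of_eq_preimage_embed ((hF.image _).union (hG.image _)) ?_ ?_ ?_
  · rintro _ (⟨Y, -, rfl⟩ | ⟨Y, -, rfl⟩)
    exacts [isPSubmanifold_sphereAtInfinity Y, isPSubmanifold_compactification Y]
  · rintro _ (⟨Y, -, rfl⟩ | ⟨Y, -, rfl⟩)
    exacts [⟨_, sphereAtInfinity_eq_preimage_embed Y⟩, ⟨_, compactification_eq_preimage_embed Y⟩]
  · rintro _ (⟨Y, hY, rfl⟩ | ⟨Y, hY, rfl⟩) _ (⟨Z, hZ, rfl⟩ | ⟨Z, hZ, rfl⟩)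
    · rw [sphereAtInfinity_inter_sphereAtInfinity]
      exact Or.inl (mem_image_of_mem _ (hFF Y hY Z hZ))
    · rw [sphereAtInfinity_inter_compactification]
      exact Or.inl (mem_image_of_mem _ (hFG Y hY Z hZ))
    · rw [inter_comm, sphereAtInfinity_inter_compactification]
      exact Or.inl (mem_image_of_mem _ (hFG Z hZ Y hY))
    · rw [compactification_inter_compactification]
      exact Or.inr (mem_image_of_mem _ (hGG Y hY Z hZ))

/-- `X` is a finite-dimensional euclidean space and `F` a finite set of linear subspaces of `X`,
stable under intersections, with `{0} ∈ F` and `X ∉ F` (which forces `X ≠ 0`, so that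
`[Nontrivial X]` is no restriction). -/
theorem mainTheorem8 {X : Type*} [NormedAddCommGroup X] [InnerProductSpace ℝ X]
    [FiniteDimensional ℝ X] [Nontrivial X]
    (F : Set (Submodule ℝ X)) (hfin : F.Finite)
    (hinf : ∀ Y ∈ F, ∀ Z ∈ F, Y ⊓ Z ∈ F) (hbot : ⊥ ∈ F) (htop : ⊤ ∉ F) :
    IsCleanSemilattice (orthantModel (Module.finrank ℝ X) 1)
      (SphericalCompactification.compactifications F) ∧
    IsCleanSemilattice (orthantModel (Module.finrank ℝ X) 1)
      (SphericalCompactification.spheresAtInfinity F) ∧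
    IsCleanSemilattice (orthantModel (Module.finrank ℝ X) 1)
      (SphericalCompactification.spheresAtInfinity F ∪
        SphericalCompactification.compactifications F) :=
  ⟨by simpa [spheresAtInfinity] using
      mainTheorem8_general finite_empty hfin (F := ∅) (by simp) hinf (by simp),
    by simpa [compactifications] using
      mainTheorem8_general hfin finite_empty (G := ∅) hinf (by simp) (by simp),
    mainTheorem8_general hfin hfin hinf hinf hinf⟩
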